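/- Let $\mathcal H,\mathcal G$ be real Hilbert spaces, let $f:\mathcal H\to\mathbb R\cup\{\pm\infty\}$ and $g:\mathcal G\to\mathbb R\cup\{\pm\infty\}$ be proper, convex and lower semicontinuous, let $h:\mathcal H\to\mathbb R$ be convex and Fréchet differentiable with $L_h$-Lipschitz continuous gradient ($L_h\ge 0$), and let $A:\mathcal H\to\mathcal G$ be a continuous linear operator. Let $S_+(\mathcal H)$ be the set of continuous linear self-adjoint positive semidefinite operators on $\mathcal H$; for $U\in S_+(\mathcal H)$ put $\|x\|_U^2=\langle x,Ux\rangle$, write $U_1\succcurlyeq U_2$ if $\|x\|_{U_1}^2\ge\|x\|_{U_2}^2$ for all $x$, and for $\alpha>0$ let $P_\alpha(\mathcal H)=\{U\in S_+(\mathcal H): U\succcurlyeq\alpha I\}$ (similarly on $\mathcal G$). Let $c>0$, $\gamma\in[0,1]$, $M_1:[0,+\infty)\to S_+(\mathcal H)$ and $M_2:[0,+\infty)\to S_+(\mathcal G)$. A map $u$ from $[0,+\infty)$ to a Banach space is locally absolutely continuous if for every $T>0$ there is a (Bochner) integrable $v$ on $[0,T]$ with $u(t)=u(0)+\int_0^t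 v(s)\,ds$ for all $t\in[0,T]$. A strong global solution with starting point $(x^0,z^0,y^0)\in\mathcal H\times\mathcal G\times\mathcal G$ is a triple of locally absolutely continuous maps $(x,z,y):[0,+\infty)\to\mathcal H\times\mathcal G\times\mathcal G$ with $(x(0),z(0),y(0))=(x^0,z^0,y^0)$ such that for almost every $t\ge 0$ $$\dot x(t)+x(t)\in(\partial f+cA^*A+M_1(t))^{-1}\big(M_1(t)x(t)+cA^*z(t)-A^*y(t)-\nabla h(x(t))\big),$$ $$\dot z(t)+z(t)\in(\partial g+cI+M_2(t))^{-1}\big(M_2(t)z(t)+cA(\gamma\dot x(t)+x(t))+y(t)\big),$$ $$\dot y(t)=cA(x(t)+\dot x(t))-c(z(t)+\dot z(t)),$$ where $\partial$ is the convex subdifferential. Assume that the Lagrangian $l(x,z,y)=f(x)+h(x)+g(z)+\langle y,Ax-z\rangle$ has a saddle point, i.e. a point $(x^*,z^*,y^*)$ with $l(x^*,z^*,y)\le l(x^*,z^*,y^*)\le l(x,z,y^*)$ for all $(x,z,y)$; that $M_1,M_2$ are locally absolutely continuous (in operator norm) and monotonically decreasing ($M_i(t_1)\succcurlyeq M_i(t_2)$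 whenever $0\le t_1\le t_2$); that $$M_1(t)+\tfrac{c(1-\gamma)}{4}A^*A-\tfrac{L_h}{2}I\in S_+(\mathcal H)\quad\text{for all }t\ge 0;$$ that $\dot M_1$ and $\dot M_2$, which exist almost everywhere on $[0,+\infty)$, are bounded in operator norm; and that one of the following holds: (I) there is $\alpha>0$ such that $M_1(t)+\frac{c(1-\gamma)}{4}A^*A-\frac{L_h}{4}I\in P_\alpha(\mathcal H)$ for every $t\ge 0$; (II) $\gamma\in[0,1)$ and there is $\alpha>0$ such that $A^*A\in P_\alpha(\mathcal H)$. Let $(x,z,y)$ be a strong global solution with starting point $(x^0,z^0,y^0)$, and for $t>0$ put $$\tilde x(t)=\frac1t\int_0^t(\dot x(s)+x(s))\,ds,\qquad \tilde z(t)=\frac1t\int_0^t(\dot z(s)+z(s))\,ds.$$ Then there exists $K\ge 0$ such that $\|A\tilde x(t)-\tilde z(t)\|\le K/t$ for every $t>0$. Moreover, for every $\bar x\in\mathcal H$ and every $t>0$ with $f(\tilde x(t))<+\infty$ and $g(\tilde z(t))<+\infty$, $$\big((f+h)(\tilde x(t))+g(\tilde z(t))\big)-\big((f+h)(\bar x)+g(A\bar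 x)\big)\le\frac{\|(x^0,z^0,y^0)-(\bar x,A\bar x,0)\|_{W(0)}^2}{2t},$$ where $W(t)=\big(M_1(t)+c(1-\gamma)A^*A,\;M_2(t)+cI,\;\tfrac1c I\big)$ acts blockwise on $\mathcal H\times\mathcal G\times\mathcal G$. -/

import Mathlib

open MeasureTheory Set
open scoped Pointwise InnerProduct

noncomputable section

namespace PrimalDual

variable {E H G : Type*}

section Convex

variable [NormedAddCommGroup H] [InnerProductSpace ℝ H]

/-- The effective domain of an extended-real-valued function. -/
def effDom (f : H → EReal) : Set H := {x | f x < ⊤}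

/-- Proper (not identically `+∞` and nowhere `-∞`), convex (convex epigraph) and lower
semicontinuous extended-real-valued functions. -/
structure ProperConvexLsc (f : H → EReal) : Prop where
  exists_ne_top : ∃ x, f x ≠ ⊤
  ne_bot : ∀ x, f x ≠ ⊥
  convex_epigraph : Convex ℝ {p : H × ℝ | f p.1 ≤ (p.2 : EReal)}
  lsc : LowerSemicontinuous f

/-- The convex subdifferential; it is empty at the points where `f` is not finite. -/
def subdiff (f : H → EReal) (x : H) : Set H :=
  {u | f x ≠ ⊥ ∧ f x ≠ ⊤ ∧ ∀ x', ((inner ℝ u (x' - x) : ℝ) : EReal) ≤ f x' - f x}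

/-- The inverse of a set-valued operator. -/
def setInv (T : H → Set H) (v : H) : Set H := {p | v ∈ T p}

/-- The squared seminorm `‖x‖²_U = ⟨x, U x⟩`. -/
def sqNorm (U : H →L[ℝ] H) (x : H) : ℝ := inner ℝ x (U x)

/-- The relation `U₁ ≽ U₂`. -/
def OpGE (U₁ U₂ : H →L[ℝ] H) : Prop := ∀ x, sqNorm U₂ x ≤ sqNorm U₁ x

/-- The class `S₊(H)` of self-adjoint positive semidefinite operators. -/
def Splus (H : Type*) [NormedAddCommGroup H] [InnerProductSpace ℝ H] : Set (H →L[ℝ] H) :=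
  {U | U.IsPositive}

/-- The class `P_α(H)` of the operators `U ∈ S₊(H)` with `U ≽ α I`. -/
def Pclass (H : Type*) [NormedAddCommGroup H] [InnerProductSpace ℝ H] (α : ℝ) :
    Set (H →L[ℝ] H) :=
  {U | U ∈ Splus H ∧ OpGE U (α • ContinuousLinearMap.id ℝ H)}

/-- An operator-valued map on `[0, +∞)` is monotonically decreasing. -/
def OpDecreasing (M : ℝ → H →L[ℝ] H) : Prop :=
  ∀ t₁ t₂, 0 ≤ t₁ → t₁ ≤ t₂ → OpGE (M t₁) (M t₂)

end Convex

/-- Locally absolutely continuous maps on `[0, +∞)`: on each interval `[0, T]` the map is the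
indefinite (Bochner) integral of an integrable function. Only the values of `x` on `[0, +∞)`
matter. -/
def LocAbsCont [NormedAddCommGroup E] [NormedSpace ℝ E] (x : ℝ → E) : Prop :=
  ∀ T, 0 < T → ∃ v : ℝ → E, IntervalIntegrable v volume 0 T ∧
    ∀ t ∈ Icc (0 : ℝ) T, x t = x 0 + ∫ s in (0 : ℝ)..t, v s

/-- The time average `(1/t) ∫₀ᵗ (ẋ(s) + x(s)) ds`. -/
def ergodic [NormedAddCommGroup E] [NormedSpace ℝ E] (x : ℝ → E) (t : ℝ) : E :=
  (1 / t) • ∫ s in (0 : ℝ)..t, (deriv x s + x s)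

section Problem

variable [NormedAddCommGroup H] [InnerProductSpace ℝ H] [CompleteSpace H]
  [NormedAddCommGroup G] [InnerProductSpace ℝ G] [CompleteSpace G]

/-- The Lagrangian `l(x, z, y) = f(x) + h(x) + g(z) + ⟨y, A x - z⟩`. -/
def lagrangian (f : H → EReal) (h : H → ℝ) (g : G → EReal) (A : H →L[ℝ] G)
    (x : H) (z y : G) : EReal :=
  f x + (h x : EReal) + g z + ((inner ℝ y (A x - z) : ℝ) : EReal)

/-- Saddle points of the Lagrangian. -/
def IsSaddlePoint (f : H → EReal) (h : H → ℝ) (g : G → EReal) (A : H →L[ℝ] G)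
    (xs : H) (zs ys : G) : Prop :=
  ∀ (x : H) (z y : G),
    lagrangian f h g A xs zs y ≤ lagrangian f h g A xs zs ys ∧
      lagrangian f h g A xs zs ys ≤ lagrangian f h g A x z ys

/-- The operator `A* A`. -/
def adjSelf (A : H →L[ℝ] G) : H →L[ℝ] H := (ContinuousLinearMap.adjoint A).comp A

/-- Strong global solutions `(x, z, y)` of the dynamical system, with starting point
`(x0, z0, y0)`. -/
structure IsStrongGlobalSolution (f : H → EReal) (h : H → ℝ) (g : G → EReal) (A : H →L[ℝ] G)
    (c γ : ℝ) (M₁ : ℝ → H →L[ℝ] H) (M₂ : ℝ → G →L[ℝ] G) (x0 : H) (z0 y0 : G)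
    (x : ℝ → H) (z y : ℝ → G) : Prop where
  locAbsCont_x : LocAbsCont x
  locAbsCont_z : LocAbsCont z
  locAbsCont_y : LocAbsCont y
  incl_x : ∀ᵐ t ∂(volume.restrict (Ici (0 : ℝ))),
    deriv x t + x t ∈
      setInv (fun p => subdiff f p + {c • adjSelf A p + M₁ t p})
        (M₁ t (x t) + c • ContinuousLinearMap.adjoint A (z t)
          - ContinuousLinearMap.adjoint A (y t) - gradient h (x t))
  incl_z : ∀ᵐ t ∂(volume.restrict (Ici (0 : ℝ))),
    deriv z t + z t ∈
      setInv (fun q => subdiff g q + {c • q + M₂ t q})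
        (M₂ t (z t) + c • A (γ • deriv x t + x t) + y t)
  eq_y : ∀ᵐ t ∂(volume.restrict (Ici (0 : ℝ))),
    deriv y t = c • A (x t + deriv x t) - c • (z t + deriv z t)
  init_x : x 0 = x0
  init_z : z 0 = z0
  init_y : y 0 = y0

/-- The three diagonal blocks of `W(t) = (M₁(t) + c(1-γ) A* A, M₂(t) + c I, (1/c) I)`. -/
def Wop (A : H →L[ℝ] G) (c γ : ℝ) (M₁ : ℝ → H →L[ℝ] H) (M₂ : ℝ → G →L[ℝ] G) (t : ℝ) :
    (H →L[ℝ] H) × (G →L[ℝ] G) × (G →L[ℝ] G) :=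
  (M₁ t + (c * (1 - γ)) • adjSelf A,
    M₂ t + c • ContinuousLinearMap.id ℝ G,
    (1 / c) • ContinuousLinearMap.id ℝ G)

/-- The squared seminorm of the Hilbert product `H × G × G` for a block-diagonal operator. -/
def sqNormProd (W : (H →L[ℝ] H) × (G →L[ℝ] G) × (G →L[ℝ] G)) (p : H × G × G) : ℝ :=
  sqNorm W.1 p.1 + sqNorm W.2.1 p.2.1 + sqNorm W.2.2 p.2.2

end Problem

end PrimalDual

end

open PrimalDual

/-! Write p = ẋ + x, q = ż + z, and let V(t) be the squared W(t)-distance from (x, z, y) to a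
reference point (x̄, A x̄, ȳ). The core estimate is, for almost every t > 0 and whenever f(x̄) and
g(A x̄) are finite, (f + h)(p) + g(q) - (f + h)(x̄) - g(A x̄) + ⟨ȳ, A p - q⟩ ≤ -V'(t)/2. It combines
the two subgradient inequalities at p and q with convexity and the descent lemma for h. The
remaining quadratic terms in the velocities are nonnegative (`energy_estimate`), and the terms in
Ṁ₁, Ṁ₂ have a favourable sign because M₁, M₂ decrease (`deriv_energy_le`).

With x̄ = x*, ȳ = y* from a saddle point, the left side is nonnegative, so V decreases and y stays
bounded. Since ẏ = c(A p - q), the residual A x̃ - z̃ equals (y(t) - y⁰)/(ct), which gives the rate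
K/t.

With ȳ = 0, the estimate is averaged over [0, t]. Jensen's inequality bounds the value at (x̃, z̃),
and V(t) ≥ 0 leaves V(0)/(2t). Jensen is applied as membership of an average in a closed convex
epigraph (`ergodic_mem_sumEpigraph`), so no integrability of f(p) or g(q) is needed. -/

/-- A continuous bilinear map applied to absolutely continuous functions is absolutely
continuous. -/
theorem AbsolutelyContinuousOnInterval.bilin {E F K : Type*}
    [NormedAddCommGroup E] [NormedSpace ℝ E] [NormedAddCommGroup F] [NormedSpace ℝ F]
    [NormedAddCommGroup K] [NormedSpace ℝ K] (B : E →L[ℝ] F →L[ℝ] K) {f : ℝ → E} {g : ℝ → F}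
    {a b : ℝ} (hf : AbsolutelyContinuousOnInterval f a b)
    (hg : AbsolutelyContinuousOnInterval g a b) :
    AbsolutelyContinuousOnInterval (fun t => B (f t) (g t)) a b := by
  obtain ⟨C, hC⟩ := hf.exists_bound
  obtain ⟨D, hD⟩ := hg.exists_bound
  unfold AbsolutelyContinuousOnInterval at hf hg
  apply squeeze_zero' ?_ ?_
    (by simpa using (hg.const_mul (‖B‖ * C)).add (hf.const_mul (‖B‖ * D)))
  · exact Filter.Eventually.of_forall <| fun _ ↦ Finset.sum_nonneg (fun i hi ↦ dist_nonneg)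
  rw [Filter.eventually_inf_principal]
  filter_upwards with (n, I) hnI
  simp only [Finset.mul_sum, ← Finset.sum_add_distrib]
  refine Finset.sum_le_sum fun i hi => ?_
  simp only [AbsolutelyContinuousOnInterval.disjWithin, mem_ofPred_eq] at hnI
  have hs := hC _ (hnI.left i hi).left
  have ht := hD _ (hnI.left i hi).right
  generalize (I i).1 = s at *
  generalize (I i).2 = t at *
  have hsplit : B (f s) (g s) - B (f t) (g t)
      = B (f s) (g s - g t) + B (f s - f t) (g t) := by
    simp only [map_sub, _root_.sub_apply]
    abel
  rw [dist_eq_norm, dist_eq_norm, dist_eq_norm, hsplit]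
  refine (norm_add_le _ _).trans (add_le_add ?_ ?_)
  · refine (B.le_opNorm₂ _ _).trans ?_
    gcongr
  · refine (B.le_opNorm₂ _ _).trans ?_
    calc ‖B‖ * ‖f s - f t‖ * ‖g t‖ ≤ ‖B‖ * ‖f s - f t‖ * D := by gcongr
      _ = ‖B‖ * D * ‖f s - f t‖ := by ring

/-! ### Calculus of locally absolutely continuous maps. -/

namespace PrimalDual.LocAbsCont

section Basic

variable {E : Type*} [NormedAddCommGroup E] [NormedSpace ℝ E]

theorem const (a : E) : LocAbsCont (fun _ : ℝ => a) :=
  fun _ _ => ⟨fun _ => 0, by simp, by simp⟩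

theorem add_const {u : ℝ → E} (hu : LocAbsCont u) (a : E) : LocAbsCont (fun t => u t + a) := by
  intro T hT
  obtain ⟨v, hv, hv'⟩ := hu T hT
  exact ⟨v, hv, fun t ht => by simp only [hv' t ht]; abel⟩

theorem sub_const {u : ℝ → E} (hu : LocAbsCont u) (a : E) : LocAbsCont (fun t => u t - a) := by
  simpa only [sub_eq_add_neg] using hu.add_const (-a)

/-- Increments of `u` are dominated by those of the real function t ↦ ∫₀ᵗ ‖v‖, whose absolute
continuity therefore passes to `u`. -/
theorem absolutelyContinuousOnInterval {u : ℝ → E} (hu : LocAbsCont u) {T : ℝ} (hT : 0 < T) :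
    AbsolutelyContinuousOnInterval u 0 T := by
  obtain ⟨v, hv, hv'⟩ := hu T hT
  have hN := hv.norm.absolutelyContinuousOnInterval_intervalIntegral (c := 0) (by simp)
  unfold AbsolutelyContinuousOnInterval at hN ⊢
  apply squeeze_zero' ?_ ?_ hN
  · exact Filter.Eventually.of_forall <| fun _ ↦ Finset.sum_nonneg (fun i hi ↦ dist_nonneg)
  rw [Filter.eventually_inf_principal]
  filter_upwards with (n, I) hnI
  refine Finset.sum_le_sum fun i hi => ?_
  simp only [AbsolutelyContinuousOnInterval.disjWithin, mem_ofPred_eq] at hnI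
  obtain ⟨hs, ht⟩ := hnI.left i hi
  generalize (I i).1 = s at *
  generalize (I i).2 = t at *
  have hint : ∀ r ∈ uIcc 0 T, IntervalIntegrable v volume 0 r := fun r hr =>
    hv.mono_set (uIcc_subset_uIcc (by simp) hr)
  have hs' := hs
  have ht' := ht
  rw [uIcc_of_le hT.le] at hs' ht'
  rw [dist_eq_norm, Real.dist_eq, hv' s hs', hv' t ht', add_sub_add_left_eq_sub,
    intervalIntegral.integral_interval_sub_left (hint s hs) (hint t ht),
    intervalIntegral.integral_interval_sub_left (hint s hs).norm (hint t ht).norm]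
  exact intervalIntegral.norm_integral_le_abs_integral_norm

variable [CompleteSpace E]

theorem ae_hasDerivAt_of_integral {u v : ℝ → E} {T : ℝ} (hT : 0 < T)
    (hv : IntervalIntegrable v volume 0 T)
    (huv : ∀ t ∈ Icc (0 : ℝ) T, u t = u 0 + ∫ s in (0 : ℝ)..t, v s) :
    ∀ᵐ t, t ∈ Ioo 0 T → HasDerivAt u (v t) t := by
  filter_upwards [hv.ae_hasDerivAt_integral] with t ht htT
  have h1 := ht (by rw [uIcc_of_le hT.le]; exact Ioo_subset_Icc_self htT) 0 (by simp)
  refine (h1.const_add (u 0)).congr_of_eventuallyEq ?_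
  filter_upwards [Ioo_mem_nhds htT.1 htT.2] with s hs
  exact huv s (Ioo_subset_Icc_self hs)

theorem ae_differentiableAt {u : ℝ → E} (hu : LocAbsCont u) :
    ∀ᵐ t : ℝ, 0 < t → DifferentiableAt ℝ u t := by
  have key : ∀ n : ℕ, ∀ᵐ t : ℝ, t ∈ Ioo 0 ((n : ℝ) + 1) → DifferentiableAt ℝ u t := by
    intro n
    have hn : (0 : ℝ) < n + 1 := by positivity
    obtain ⟨v, hv, hv'⟩ := hu _ hn
    filter_upwards [ae_hasDerivAt_of_integral hn hv hv'] with t ht htn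
    exact (ht htn).differentiableAt
  filter_upwards [ae_all_iff.2 key] with t ht h0
  obtain ⟨n, hn⟩ := exists_nat_gt t
  exact ht n ⟨h0, by linarith⟩

/-- By Lebesgue differentiation the density `v`, which may depend on `T`, agrees almost everywhere
with `deriv u`. -/
theorem intervalIntegrable_deriv_and_integral {u : ℝ → E} (hu : LocAbsCont u) {T : ℝ}
    (hT : 0 < T) :
    IntervalIntegrable (deriv u) volume 0 T ∧ ∫ s in (0 : ℝ)..T, deriv u s = u T - u 0 := by
  obtain ⟨v, hv, hv'⟩ := hu T hT
  -- The representation on `[0, T]` says nothing beyond `T`, so the two-sided derivative is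
  -- identified only in the open interval; the endpoint is a null set.
  have hne : ∀ᵐ t : ℝ, t ≠ T := by simp [ae_iff, measure_singleton]
  have hae : ∀ᵐ t : ℝ, t ∈ uIoc 0 T → v t = deriv u t := by
    filter_upwards [ae_hasDerivAt_of_integral hT hv hv', hne] with t ht hn htT
    rw [uIoc_of_le hT.le] at htT
    exact (ht ⟨htT.1, lt_of_le_of_ne htT.2 hn⟩).deriv.symm
  refine ⟨hv.congr_ae ((ae_restrict_iff' measurableSet_uIoc).2 hae), ?_⟩
  rw [← intervalIntegral.integral_congr_ae hae, hv' T ⟨hT.le, le_rfl⟩]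
  abel

theorem intervalIntegrable_deriv_add {u : ℝ → E} (hu : LocAbsCont u) {T : ℝ} (hT : 0 < T) :
    IntervalIntegrable (fun s => deriv u s + u s) volume 0 T :=
  (hu.intervalIntegrable_deriv_and_integral hT).1.add
    (hu.absolutelyContinuousOnInterval hT).continuousOn.intervalIntegrable

end Basic

variable {H : Type*} [NormedAddCommGroup H] [InnerProductSpace ℝ H]

theorem absolutelyContinuousOnInterval_sqNorm {U : ℝ → H →L[ℝ] H} {u : ℝ → H}
    (hU : LocAbsCont U) (hu : LocAbsCont u) {T : ℝ} (hT : 0 < T) :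
    AbsolutelyContinuousOnInterval (fun t => sqNorm (U t) (u t)) 0 T := by
  have h1 := (hU.absolutelyContinuousOnInterval hT).bilin
    (ContinuousLinearMap.id ℝ (H →L[ℝ] H)) (hu.absolutelyContinuousOnInterval hT)
  exact (hu.absolutelyContinuousOnInterval hT).bilin (innerSL ℝ) h1

end PrimalDual.LocAbsCont

/-! ### Differentiation of time-dependent squared seminorms. -/

section

variable {H : Type*} [NormedAddCommGroup H] [InnerProductSpace ℝ H]

theorem PrimalDual.OpDecreasing.sqNorm_deriv_nonpos {M : ℝ → H →L[ℝ] H} (hM : OpDecreasing M)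
    {t : ℝ} (ht : 0 < t) {M' : H →L[ℝ] H} (hd : HasDerivAt M M' t) (w : H) :
    sqNorm M' w ≤ 0 := by
  have h1 : HasDerivAt (fun s => sqNorm (M s) w) (sqNorm M' w) t := by
    have := (hasDerivAt_const t w).inner ℝ (hd.clm_apply (hasDerivAt_const t w))
    simpa [sqNorm] using this
  -- For a fixed vector the order on operators becomes monotonicity of a scalar function, whose
  -- derivative has a sign.
  have hanti : AntitoneOn (fun s => sqNorm (M s) w) (Ioi 0) :=
    fun r hr s _ hrs => hM r s (le_of_lt hr) hrs w
  have h2 := hanti.derivWithin_nonpos (x := t)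
  rwa [derivWithin_of_isOpen isOpen_Ioi ht, h1.deriv] at h2

theorem PrimalDual.hasDerivAt_sqNorm {U : ℝ → H →L[ℝ] H} {U' : H →L[ℝ] H} {u : ℝ → H} {u' : H}
    {t : ℝ} (hU : HasDerivAt U U' t) (hu : HasDerivAt u u' t) (hsymm : (U t).IsSymmetric) :
    HasDerivAt (fun s => sqNorm (U s) (u s))
      (2 * inner ℝ u' (U t (u t)) + sqNorm U' (u t)) t := by
  have h1 := hu.inner ℝ (hU.clm_apply hu)
  refine h1.congr_deriv ?_
  have h2 : inner ℝ (u t) (U t u') = inner ℝ u' (U t (u t)) := by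
    rw [real_inner_comm]
    exact hsymm u' (u t)
  simp only [inner_add_right, h2, sqNorm]
  ring

end

/-! ### Inequalities for smooth convex functions. -/

namespace PrimalDual

section

variable {H : Type*} [NormedAddCommGroup H] [InnerProductSpace ℝ H] [CompleteSpace H]

/-- The derivative of a function on a Hilbert space along a line. -/
theorem hasDerivAt_comp_line {h : H → ℝ} (h_diff : Differentiable ℝ h) (u d : H) (s : ℝ) :
    HasDerivAt (fun r : ℝ => h (u + r • d)) (inner ℝ (gradient h (u + s • d)) d) s := by
  have h1 := (h_diff (u + s • d)).hasGradientAt.hasFDerivAt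
  have h2 : HasDerivAt (fun r : ℝ => u + r • d) d s := by
    simpa using ((hasDerivAt_id s).smul_const d).const_add u
  exact (h1.comp_hasDerivAt s h2).congr_deriv (by simp)

/-- The descent lemma for functions with Lipschitz continuous gradient. -/
theorem le_add_inner_gradient_add {h : H → ℝ} {L : ℝ} (h_diff : Differentiable ℝ h)
    (h_lip : ∀ u v : H, ‖gradient h u - gradient h v‖ ≤ L * ‖u - v‖) (u d : H) :
    h (u + d) ≤ h u + inner ℝ (gradient h u) d + L / 2 * ‖d‖ ^ 2 := by
  have hB : ∀ s : ℝ, HasDerivAt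
      (fun r : ℝ => h u + r * inner ℝ (gradient h u) d + L / 2 * ‖d‖ ^ 2 * r ^ 2)
      (inner ℝ (gradient h u) d + L * ‖d‖ ^ 2 * s) s := by
    intro s
    have := (((hasDerivAt_id s).mul_const (inner ℝ (gradient h u) d)).const_add (h u)).add
      ((hasDerivAt_pow 2 s).const_mul (L / 2 * ‖d‖ ^ 2))
    refine this.congr_deriv ?_
    simp
    ring
  -- Along the segment, `h` and the quadratic agree at 0, and the Lipschitz bound makes the
  -- quadratic grow at least as fast; the claim is the comparison at 1.
  have key := image_le_of_deriv_right_le_deriv_boundary (a := 0) (b := 1)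
    (f := fun r : ℝ => h (u + r • d))
    (fun s _ => (hasDerivAt_comp_line h_diff u d s).continuousAt.continuousWithinAt)
    (fun s _ => (hasDerivAt_comp_line h_diff u d s).hasDerivWithinAt)
    (B := fun r : ℝ => h u + r * inner ℝ (gradient h u) d + L / 2 * ‖d‖ ^ 2 * r ^ 2)
    (by simp) (fun s _ => (hB s).continuousAt.continuousWithinAt)
    (fun s _ => (hB s).hasDerivWithinAt) ?_ (x := 1) (by simp)
  · simpa using key
  · intro s hs
    have h1 : inner ℝ (gradient h (u + s • d) - gradient h u) d ≤ L * ‖d‖ ^ 2 * s := by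
      refine (real_inner_le_norm _ _).trans ?_
      have h2 := h_lip (u + s • d) u
      rw [add_sub_cancel_left, norm_smul, Real.norm_of_nonneg hs.1] at h2
      calc _ ≤ L * (s * ‖d‖) * ‖d‖ := by gcongr
        _ = _ := by ring
    rw [inner_sub_left] at h1
    linarith

/-- The gradient inequality for differentiable convex functions. -/
theorem add_inner_gradient_le {h : H → ℝ} (h_conv : ConvexOn ℝ univ h)
    (h_diff : Differentiable ℝ h) (u d : H) :
    h u + inner ℝ (gradient h u) d ≤ h (u + d) := by
  have hc : ConvexOn ℝ univ (fun r : ℝ => h (u + r • d)) := by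
    have := h_conv.comp_affineMap (AffineMap.lineMap u (u + d))
    simpa [Function.comp_def, AffineMap.lineMap_apply, add_comm] using this
  have hd := hasDerivAt_comp_line h_diff u d 0
  have := hc.le_slope_of_hasDerivAt (mem_univ 0) (mem_univ 1) one_pos hd
  simp [slope_def_field] at this ⊢
  linarith

end

/-! ### Extended-real arithmetic and the epigraph of the separable objective. -/

section Epigraph

variable {H G : Type*} [NormedAddCommGroup H] [InnerProductSpace ℝ H]
  [NormedAddCommGroup G] [InnerProductSpace ℝ G]

theorem ProperConvexLsc.exists_coe {f : H → EReal} (hf : ProperConvexLsc f) {u : H}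
    (hu : f u ≠ ⊤) : ∃ r : ℝ, f u = r :=
  ⟨(f u).toReal, (EReal.coe_toReal hu (hf.ne_bot u)).symm⟩

/-- As neither function takes the value `⊥`, an infinite summand could not be cancelled, so a real
upper bound on the sum forces both values to be finite. -/
theorem ProperConvexLsc.exists_coe_of_add_le {f : H → EReal} {g : G → EReal}
    (hf : ProperConvexLsc f) (hg : ProperConvexLsc g) {u : H} {v : G} {a r : ℝ}
    (hle : f u + (a : EReal) + g v ≤ (r : EReal)) :
    ∃ fu gv : ℝ, f u = fu ∧ g v = gv ∧ fu + a + gv ≤ r := by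
  have hfu : f u ≠ ⊤ := by
    intro h
    rw [h, EReal.top_add_coe, EReal.top_add_of_ne_bot (hg.ne_bot v)] at hle
    exact absurd hle (by simp)
  obtain ⟨fu, hfu⟩ := hf.exists_coe hfu
  have hgv : g v ≠ ⊤ := by
    intro h
    rw [h, hfu, ← EReal.coe_add, EReal.coe_add_top] at hle
    exact absurd hle (by simp)
  obtain ⟨gv, hgv⟩ := hg.exists_coe hgv
  refine ⟨fu, gv, hfu, hgv, ?_⟩
  rw [hfu, hgv] at hle
  exact_mod_cast hle

/-- The epigraph of the separable function `(u, v) ↦ f u + h u + g v`. -/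
def sumEpigraph (f : H → EReal) (h : H → ℝ) (g : G → EReal) : Set ((H × G) × ℝ) :=
  {P | f P.1.1 + (h P.1.1 : EReal) + g P.1.2 ≤ (P.2 : EReal)}

theorem convex_sumEpigraph {f : H → EReal} {h : H → ℝ} {g : G → EReal}
    (hf : ProperConvexLsc f) (hh : ConvexOn ℝ univ h) (hg : ProperConvexLsc g) :
    Convex ℝ (sumEpigraph f h g) := by
  rintro ⟨⟨u, v⟩, r⟩ hP ⟨⟨u', v'⟩, r'⟩ hP' a b ha hb hab
  obtain ⟨fu, gv, hfu, hgv, hr⟩ := hf.exists_coe_of_add_le hg hP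
  obtain ⟨fu', gv', hfu', hgv', hr'⟩ := hf.exists_coe_of_add_le hg hP'
  have h1 : f (a • u + b • u') ≤ ((a * fu + b * fu' : ℝ) : EReal) :=
    hf.convex_epigraph (x := (u, fu)) hfu.le (y := (u', fu')) hfu'.le ha hb hab
  have h2 : g (a • v + b • v') ≤ ((a * gv + b * gv' : ℝ) : EReal) :=
    hg.convex_epigraph (x := (v, gv)) hgv.le (y := (v', gv')) hgv'.le ha hb hab
  have h3 : h (a • u + b • u') ≤ a * h u + b * h u' :=
    hh.2 (mem_univ u) (mem_univ u') ha hb hab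
  have h4 := add_le_add (add_le_add h1 (EReal.coe_le_coe_iff.2 h3)) h2
  refine h4.trans ?_
  dsimp only at hr hr'
  have h5 := mul_le_mul_of_nonneg_left hr ha
  have h6 := mul_le_mul_of_nonneg_left hr' hb
  have h7 : a * fu + b * fu' + (a * h u + b * h u') + (a * gv + b * gv') ≤ a * r + b * r' := by
    linarith
  exact_mod_cast h7

theorem isClosed_sumEpigraph {f : H → EReal} {h : H → ℝ} {g : G → EReal}
    (hf : ProperConvexLsc f) (hh : Continuous h) (hg : ProperConvexLsc g) :
    IsClosed (sumEpigraph f h g) := by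
  have h1 : LowerSemicontinuous fun P : H × G => f P.1 :=
    hf.lsc.comp continuous_fst
  have h2 : LowerSemicontinuous fun P : H × G => ((h P.1 : ℝ) : EReal) :=
    (continuous_coe_real_ereal.comp (hh.comp continuous_fst)).lowerSemicontinuous
  have h3 : LowerSemicontinuous fun P : H × G => g P.2 :=
    hg.lsc.comp continuous_snd
  -- Lower semicontinuity of a sum needs continuity of `EReal` addition at the values; the bad pairs
  -- (`⊤`, `⊥`) and (`⊥`, `⊤`) do not occur, since `h` is real and `f`, `g` avoid `⊥`.
  have h4 := (h1.add' h2 fun P => EReal.continuousAt_add (by simp) (by simp)).add' h3 fun P =>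
    EReal.continuousAt_add (Or.inr (hg.ne_bot _))
      (Or.inl (by simp [EReal.add_eq_bot_iff, hf.ne_bot]))
  exact (lowerSemicontinuous_iff_isClosed_epigraph.1 h4).preimage
    ((continuous_fst.prodMk (continuous_coe_real_ereal.comp continuous_snd)))

end Epigraph

/-! ### Saddle points of the Lagrangian. -/

section Saddle

variable {H G : Type*} [NormedAddCommGroup H] [InnerProductSpace ℝ H]
  [NormedAddCommGroup G] [InnerProductSpace ℝ G]

/-- A saddle point is feasible, has a finite value, and minimizes the Lagrangian. -/
theorem IsSaddlePoint.feasible_and_le {f : H → EReal} {h : H → ℝ} {g : G → EReal} {A : H →L[ℝ] G}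
    {xs : H} {zs ys : G} (hs : IsSaddlePoint f h g A xs zs ys)
    (hf : ProperConvexLsc f) (hg : ProperConvexLsc g) :
    zs = A xs ∧ ∃ fs gs : ℝ, f xs = fs ∧ g (A xs) = gs ∧ ∀ (u : H) (v : G) (fu gv : ℝ),
      f u = fu → g v = gv → fs + h xs + gs ≤ fu + h u + gv + inner ℝ ys (A u - v) := by
  have hle : ∀ (u : H) (v : G) (fu gv : ℝ), f u = fu → g v = gv →
      lagrangian f h g A xs zs ys ≤ ((fu + h u + gv + inner ℝ ys (A u - v) : ℝ) : EReal) := by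
    intro u v fu gv hfu hgv
    have := (hs u v ys).2
    rw [lagrangian.eq_1 f h g A u, hfu, hgv] at this
    exact_mod_cast this
  obtain ⟨u, hu⟩ := hf.exists_ne_top
  obtain ⟨v, hv⟩ := hg.exists_ne_top
  obtain ⟨fu, hfu⟩ := hf.exists_coe hu
  obtain ⟨gv, hgv⟩ := hg.exists_coe hv
  have h0 := hle u v fu gv hfu hgv
  -- Comparison with a point where `f` and `g` are finite bounds the saddle value from above, hence
  -- makes its terms finite.
  have hfin : f xs + (h xs : EReal) + g zs
      ≤ ((fu + h u + gv + inner ℝ ys (A u - v) - inner ℝ ys (A xs - zs) : ℝ) : EReal) := by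
    rw [EReal.coe_sub]
    exact EReal.le_sub_iff_add_le (by simp) (by simp) |>.2 h0
  obtain ⟨fs, gs, hfs, hgs, -⟩ := hf.exists_coe_of_add_le hg hfin
  have hz : zs = A xs := by
    -- Moving the multiplier by the residual raises the Lagrangian by ‖A xs - zs‖², while `ys`
    -- maximizes it; so the residual vanishes.
    have h1 := (hs xs zs (ys + (A xs - zs))).1
    simp only [lagrangian, hfs, hgs] at h1
    have h2 : fs + h xs + gs + inner ℝ (ys + (A xs - zs)) (A xs - zs)
        ≤ fs + h xs + gs + inner ℝ ys (A xs - zs) := by exact_mod_cast h1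
    rw [inner_add_left, real_inner_self_eq_norm_sq] at h2
    have h3 : ‖A xs - zs‖ = 0 := by nlinarith [norm_nonneg (A xs - zs)]
    exact (sub_eq_zero.1 (norm_eq_zero.1 h3)).symm
  subst hz
  refine ⟨rfl, fs, gs, hfs, hgs, fun u v fu gv hfu hgv => ?_⟩
  have h1 := hle u v fu gv hfu hgv
  simp only [lagrangian, hfs, hgs, sub_self, inner_zero_right] at h1
  have h2 : fs + h xs + gs + 0 ≤ fu + h u + gv + inner ℝ ys (A u - v) := by exact_mod_cast h1
  linarith

end Saddle

end PrimalDual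

/-! ### The pointwise energy inequality. -/

namespace PrimalDual

theorem exists_coe_and_inner_le_of_mem_subdiff {H : Type*} [NormedAddCommGroup H]
    [InnerProductSpace ℝ H] {f : H → EReal} {p v : H} (hv : v ∈ subdiff f p)
    {xb : H} {fb : ℝ} (hfb : f xb = fb) :
    ∃ fp : ℝ, f p = fp ∧ inner ℝ v (xb - p) ≤ fb - fp := by
  obtain ⟨hbot, htop, hle⟩ := hv
  obtain ⟨fp, hfp⟩ : ∃ r : ℝ, f p = r := ⟨(f p).toReal, (EReal.coe_toReal htop hbot).symm⟩
  refine ⟨fp, hfp, ?_⟩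
  have := hle xb
  rw [hfb, hfp] at this
  exact_mod_cast this

/-- Nonnegativity of the quadratic remainder in the energy estimate. -/
theorem quadratic_remainder_nonneg {G : Type*} [NormedAddCommGroup G]
    [InnerProductSpace ℝ G] {c γ : ℝ} (hc : 0 < c) (hγ : γ ∈ Icc (0 : ℝ) 1) (a d e : G) :
    0 ≤ 3 / 4 * (c * (1 - γ)) * ‖a‖ ^ 2 + c * ‖d‖ ^ 2 + c * ‖e‖ ^ 2 + c * inner ℝ d e
      - c * (1 - γ) * inner ℝ a e := by
  obtain ⟨h0, h1⟩ := hγ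
  -- Completing the squares in `d` and in `a` costs c/4 and c(1-γ)/3 of the coefficient of ‖e‖²;
  -- what is left, c(3/4 - (1-γ)/3), is nonnegative since 1 - γ ≤ 1.
  have e1 := norm_add_sq_real d ((1 / 2 : ℝ) • e)
  have e2 := norm_sub_sq_real a ((2 / 3 : ℝ) • e)
  rw [norm_smul, inner_smul_right] at e1 e2
  norm_num at e1 e2
  have k1 : 0 ≤ c * ‖d + (1 / 2 : ℝ) • e‖ ^ 2 := by positivity
  have k2 : 0 ≤ 3 / 4 * (c * (1 - γ)) * ‖a - (2 / 3 : ℝ) • e‖ ^ 2 := by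
    have : 0 ≤ 1 - γ := by linarith
    positivity
  have k3 : 0 ≤ c * (3 / 4 - (1 - γ) / 3) * ‖e‖ ^ 2 := by
    have : 0 ≤ 3 / 4 - (1 - γ) / 3 := by linarith
    positivity
  norm_num at k1 k2
  rw [e1] at k1
  rw [e2] at k2
  linarith

variable {H G : Type*} [NormedAddCommGroup H] [InnerProductSpace ℝ H] [CompleteSpace H]
  [NormedAddCommGroup G] [InnerProductSpace ℝ G] [CompleteSpace G]

/-- The energy estimate at a single time, for the velocities `dx`, `dz`, `dy` and the state
`x`, `z`, `y`, against the reference point `(xb, A xb, yb)`. -/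
theorem energy_estimate {A : H →L[ℝ] G} {L c γ : ℝ} {M : H →L[ℝ] H} {N : G →L[ℝ] G}
    {x dx xb v : H} {z dz y dy yb : G} {fp fb gq gb hp hb : ℝ}
    (hc : 0 < c) (hγ : γ ∈ Icc (0 : ℝ) 1)
    (hf : inner ℝ (M x + c • ContinuousLinearMap.adjoint A z - ContinuousLinearMap.adjoint A y
      - v - (c • adjSelf A (dx + x) + M (dx + x))) (xb - (dx + x)) ≤ fb - fp)
    (hg : inner ℝ (N z + c • A (γ • dx + x) + y - (c • (dz + z) + N (dz + z)))
      (A xb - (dz + z)) ≤ gb - gq)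
    (hh : hp - hb ≤ inner ℝ v (dx + x - xb) + L / 2 * ‖dx‖ ^ 2)
    (hy : dy = c • A (x + dx) - c • (z + dz))
    (hMs : M.IsSymmetric) (hNs : N.IsSymmetric)
    (hM : 0 ≤ sqNorm (M + (c * (1 - γ) / 4) • adjSelf A
      - (L / 2) • ContinuousLinearMap.id ℝ H) dx)
    (hN : 0 ≤ sqNorm N dz) :
    fp + hp + gq - (fb + hb + gb) + inner ℝ yb (A (dx + x) - (dz + z)) ≤
      -(inner ℝ dx ((M + (c * (1 - γ)) • adjSelf A) (x - xb))
        + inner ℝ dz ((N + c • ContinuousLinearMap.id ℝ G) (z - A xb))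
        + inner ℝ dy (((1 / c) • ContinuousLinearMap.id ℝ G) (y - yb))) := by
  -- The reference point is moved to the origin, and `w` is then expressed through the residual `e`
  -- = A p - q, so that `dy = c • e`.
  obtain ⟨u, rfl⟩ : ∃ u, x = u + xb := ⟨x - xb, by abel⟩
  obtain ⟨w, rfl⟩ : ∃ w, z = w + A xb := ⟨z - A xb, by abel⟩
  obtain ⟨e, he⟩ : ∃ e, e = A u + A dx - w - dz := ⟨_, rfl⟩
  have hw : w = A u + A dx - e - dz := by rw [he]; abel
  have hy' : dy = c • e := by
    rw [hy, he]
    simp only [map_add, smul_add, smul_sub]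
    abel
  have h1 : xb - (dx + (u + xb)) = -(dx + u) := by abel
  have h2 : A xb - (dz + (w + A xb)) = e - (A u + A dx) := by rw [hw]; abel
  have h3 : A (dx + (u + xb)) - (dz + (w + A xb)) = e := by
    rw [hw]; simp only [map_add]; abel
  have h4 : dx + (u + xb) - xb = dx + u := by abel
  have h5 : u + xb - xb = u := by abel
  have h6 : w + A xb - A xb = w := by abel
  have hfv : M (u + xb) + c • ContinuousLinearMap.adjoint A (w + A xb)
      - ContinuousLinearMap.adjoint A y - v - (c • adjSelf A (dx + (u + xb)) + M (dx + (u + xb)))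
      = -M dx - v - ContinuousLinearMap.adjoint A (c • (e + dz) + y) := by
    rw [hw]
    simp only [adjSelf, ContinuousLinearMap.comp_apply, map_add, map_sub, map_smul]
    module
  have hgv : N (w + A xb) + c • A (γ • dx + (u + xb)) + y
      - (c • (dz + (w + A xb)) + N (dz + (w + A xb)))
      = -N dz + c • e - (c * (1 - γ)) • A dx + y := by
    rw [hw]
    simp only [map_add, map_sub, map_smul]
    module
  rw [hfv, h1, inner_neg_right] at hf
  rw [hgv, h2] at hg
  rw [h4] at hh
  rw [h3, h5, h6, hy']
  -- Of the term c(1-γ)‖A dx‖², one quarter goes with `M` to absorb (L/2)‖dx‖² through `hM`; the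
  -- other three quarters enter this remainder.
  have hq := quadratic_remainder_nonneg hc hγ (A dx) dz e
  have hMu : inner ℝ dx (M u) = inner ℝ (M dx) u := (hMs dx u).symm
  have hMd : inner ℝ dx (M dx) = inner ℝ (M dx) dx := real_inner_comm _ _
  have hNd : inner ℝ dz (N dz) = inner ℝ (N dz) dz := real_inner_comm _ _
  have hNw : inner ℝ dz (N w) = inner ℝ (N dz) (A u) + inner ℝ (N dz) (A dx)
      - inner ℝ (N dz) e - inner ℝ (N dz) dz := by
    rw [show inner ℝ dz (N w) = inner ℝ (N dz) w from (hNs dz w).symm, hw]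
    simp only [inner_add_right, inner_sub_right]
  have hAA : ∀ p q : H, inner ℝ p (adjSelf A q) = inner ℝ (A p) (A q) := fun p q =>
    ContinuousLinearMap.adjoint_inner_right A p (A q)
  have hey : inner ℝ (c • e) (((1 / c) • ContinuousLinearMap.id ℝ G) (y - yb))
      = inner ℝ e y - inner ℝ e yb := by
    simp only [_root_.smul_apply, ContinuousLinearMap.id_apply, inner_smul_left,
      inner_smul_right, inner_sub_right]
    simp
    field_simp
  have hdw : inner ℝ dz w = inner ℝ dz (A u) + inner ℝ dz (A dx) - inner ℝ dz e
      - ‖dz‖ ^ 2 := by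
    rw [hw]
    simp only [inner_add_right, inner_sub_right, real_inner_self_eq_norm_sq]
  rw [hey]
  simp only [sqNorm, _root_.add_apply, _root_.sub_apply, _root_.smul_apply,
    ContinuousLinearMap.id_apply, inner_add_right, inner_sub_right, inner_smul_right, hAA,
    hMu, hMd, hNd, hNw, hdw, real_inner_self_eq_norm_sq] at hM hN ⊢
  simp only [inner_add_left, inner_sub_left, inner_neg_left, inner_smul_left, inner_add_right,
    inner_sub_right, ContinuousLinearMap.adjoint_inner_left, real_inner_self_eq_norm_sq,
    RCLike.conj_to_real] at hf hg hh
  have c1 : inner ℝ e (A u) = inner ℝ (A u) e := real_inner_comm _ _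
  have c2 : inner ℝ e (A dx) = inner ℝ (A dx) e := real_inner_comm _ _
  have c3 : inner ℝ (A dx) (A u) = inner ℝ (A u) (A dx) := real_inner_comm _ _
  have c4 : inner ℝ y e = inner ℝ e y := real_inner_comm _ _
  have c5 : inner ℝ yb e = inner ℝ e yb := real_inner_comm _ _
  rw [c1, c2, c3, c4] at hg
  rw [c1, c2] at hf
  rw [c3, c5]
  linarith

end PrimalDual

/-! ### The energy along a trajectory, and time averages. -/

namespace PrimalDual

variable {H G : Type*} [NormedAddCommGroup H] [InnerProductSpace ℝ H] [CompleteSpace H]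
  [NormedAddCommGroup G] [InnerProductSpace ℝ G] [CompleteSpace G]

/-- The squared distance of the state to `(xb, A xb, yb)` in the time-dependent seminorm. -/
noncomputable def energy (A : H →L[ℝ] G) (c γ : ℝ) (M₁ : ℝ → H →L[ℝ] H) (M₂ : ℝ → G →L[ℝ] G)
    (x : ℝ → H) (z y : ℝ → G) (xb : H) (yb : G) (t : ℝ) : ℝ :=
  sqNormProd (Wop A c γ M₁ M₂ t) ((x t, z t, y t) - (xb, A xb, yb))

theorem energy_eq (A : H →L[ℝ] G) (c γ : ℝ) (M₁ : ℝ → H →L[ℝ] H) (M₂ : ℝ → G →L[ℝ] G)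
    (x : ℝ → H) (z y : ℝ → G) (xb : H) (yb : G) :
    energy A c γ M₁ M₂ x z y xb yb = fun t =>
      sqNorm (M₁ t + (c * (1 - γ)) • adjSelf A) (x t - xb)
      + sqNorm (M₂ t + c • ContinuousLinearMap.id ℝ G) (z t - A xb)
      + sqNorm ((1 / c) • ContinuousLinearMap.id ℝ G) (y t - yb) := rfl

theorem inner_adjSelf (A : H →L[ℝ] G) (p q : H) :
    inner ℝ p (adjSelf A q) = inner ℝ (A p) (A q) :=
  ContinuousLinearMap.adjoint_inner_right A p (A q)

theorem isSymmetric_add_smul_adjSelf {M : H →L[ℝ] H} (hM : M.IsSymmetric) (A : H →L[ℝ] G)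
    (r : ℝ) : (M + r • adjSelf A).IsSymmetric := by
  intro p q
  have h1 : inner ℝ (M p) q = inner ℝ p (M q) := hM p q
  change inner ℝ (M p + r • adjSelf A p) q = inner ℝ p (M q + r • adjSelf A q)
  rw [inner_add_left, inner_add_right, inner_smul_left, inner_smul_right, h1, inner_adjSelf,
    real_inner_comm q, inner_adjSelf, real_inner_comm (A p)]
  rfl

theorem isSymmetric_add_smul_id {G : Type*} [NormedAddCommGroup G] [InnerProductSpace ℝ G]
    {N : G →L[ℝ] G} (hN : N.IsSymmetric) (r : ℝ) :
    (N + r • ContinuousLinearMap.id ℝ G).IsSymmetric := by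
  intro p q
  have h1 : inner ℝ (N p) q = inner ℝ p (N q) := hN p q
  change inner ℝ (N p + r • p) q = inner ℝ p (N q + r • q)
  rw [inner_add_left, inner_add_right, inner_smul_left, inner_smul_right, h1]
  rfl

theorem sqNorm_nonneg_of_mem_Splus {H : Type*} [NormedAddCommGroup H] [InnerProductSpace ℝ H]
    {U : H →L[ℝ] H} (hU : U ∈ Splus H) (u : H) : 0 ≤ sqNorm U u := by
  have h1 := (show U.IsPositive from hU).inner_nonneg_right u
  exact h1

variable {f : H → EReal} {h : H → ℝ} {g : G → EReal} {A : H →L[ℝ] G} {L c γ : ℝ}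
    {M₁ : ℝ → H →L[ℝ] H} {M₂ : ℝ → G →L[ℝ] G} {x0 : H} {z0 y0 : G} {x : ℝ → H} {z y : ℝ → G}

/-- The first two blocks are positive semidefinite and are dropped. This bounds `y` by the energy
and also shows that the energy is nonnegative. -/
theorem norm_sq_div_le_energy (hc : 0 < c) (hγ : γ ∈ Icc (0 : ℝ) 1) {t : ℝ}
    (hM₁ : M₁ t ∈ Splus H) (hM₂ : M₂ t ∈ Splus G) (xb : H) (yb : G) :
    ‖y t - yb‖ ^ 2 / c ≤ energy A c γ M₁ M₂ x z y xb yb t := by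
  have h1 := sqNorm_nonneg_of_mem_Splus hM₁ (x t - xb)
  have h2 := sqNorm_nonneg_of_mem_Splus hM₂ (z t - A xb)
  have h3 : 0 ≤ c * (1 - γ) := mul_nonneg hc.le (by linarith [hγ.2])
  have h4 : 0 ≤ c * (1 - γ) * ‖A (x t - xb)‖ ^ 2 := by positivity
  have h5 : 0 ≤ c * ‖z t - A xb‖ ^ 2 := by positivity
  rw [energy_eq]
  simp only [sqNorm, _root_.add_apply, _root_.smul_apply, ContinuousLinearMap.id_apply,
    inner_add_right, inner_smul_right, inner_adjSelf, real_inner_self_eq_norm_sq] at *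
  rw [div_eq_inv_mul, one_div]
  linarith

theorem absolutelyContinuousOnInterval_energy (hM₁ : LocAbsCont M₁) (hM₂ : LocAbsCont M₂)
    (hx : LocAbsCont x) (hz : LocAbsCont z) (hy : LocAbsCont y) (xb : H) (yb : G) {T : ℝ}
    (hT : 0 < T) :
    AbsolutelyContinuousOnInterval (energy A c γ M₁ M₂ x z y xb yb) 0 T := by
  rw [energy_eq]
  exact (((hM₁.add_const _).absolutelyContinuousOnInterval_sqNorm (hx.sub_const _) hT).fun_add
    ((hM₂.add_const _).absolutelyContinuousOnInterval_sqNorm (hz.sub_const _) hT)).fun_add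
    ((LocAbsCont.const _).absolutelyContinuousOnInterval_sqNorm (hy.sub_const _) hT)

/-- Along decreasing operators, the derivative of the energy only sees the velocities. -/
theorem deriv_energy_le (hM₁s : ∀ t, 0 ≤ t → M₁ t ∈ Splus H) (hM₂s : ∀ t, 0 ≤ t → M₂ t ∈ Splus G)
    (hM₁_dec : OpDecreasing M₁) (hM₂_dec : OpDecreasing M₂) {t : ℝ} (ht : 0 < t)
    (hM₁ : DifferentiableAt ℝ M₁ t) (hM₂ : DifferentiableAt ℝ M₂ t)
    (hx : DifferentiableAt ℝ x t) (hz : DifferentiableAt ℝ z t) (hy : DifferentiableAt ℝ y t)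
    (xb : H) (yb : G) :
    deriv (energy A c γ M₁ M₂ x z y xb yb) t ≤
      2 * (inner ℝ (deriv x t) ((M₁ t + (c * (1 - γ)) • adjSelf A) (x t - xb))
        + inner ℝ (deriv z t) ((M₂ t + c • ContinuousLinearMap.id ℝ G) (z t - A xb))
        + inner ℝ (deriv y t) (((1 / c) • ContinuousLinearMap.id ℝ G) (y t - yb))) := by
  have h1 := hasDerivAt_sqNorm (hM₁.hasDerivAt.add_const ((c * (1 - γ)) • adjSelf A))
    (hx.hasDerivAt.sub_const xb)
    (isSymmetric_add_smul_adjSelf (hM₁s t ht.le).isSymmetric A _)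
  have h2 := hasDerivAt_sqNorm (hM₂.hasDerivAt.add_const (c • ContinuousLinearMap.id ℝ G))
    (hz.hasDerivAt.sub_const (A xb)) (isSymmetric_add_smul_id (hM₂s t ht.le).isSymmetric _)
  have h3 := hasDerivAt_sqNorm (hasDerivAt_const t ((1 / c) • ContinuousLinearMap.id ℝ G))
    (hy.hasDerivAt.sub_const yb)
    (by simpa using isSymmetric_add_smul_id (G := G) (N := 0) (by intro p q; simp) (1 / c))
  have h4 := hM₁_dec.sqNorm_deriv_nonpos ht hM₁.hasDerivAt (x t - xb)
  have h5 := hM₂_dec.sqNorm_deriv_nonpos ht hM₂.hasDerivAt (z t - A xb)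
  have h6 : sqNorm (0 : G →L[ℝ] G) (y t - yb) = 0 := by simp [sqNorm]
  rw [energy_eq, ((h1.fun_add h2).fun_add h3).deriv, h6]
  linarith

/-- The energy dissipation inequality along a strong global solution. -/
theorem IsStrongGlobalSolution.ae_dissipation
    (h_sol : IsStrongGlobalSolution f h g A c γ M₁ M₂ x0 z0 y0 x z y)
    (h_conv : ConvexOn ℝ univ h) (h_diff : Differentiable ℝ h)
    (h_lip : ∀ u v : H, ‖gradient h u - gradient h v‖ ≤ L * ‖u - v‖)
    (hc : 0 < c) (hγ : γ ∈ Icc (0 : ℝ) 1)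
    (hM₁ : ∀ t, 0 ≤ t → M₁ t ∈ Splus H) (hM₂ : ∀ t, 0 ≤ t → M₂ t ∈ Splus G)
    (hM₁_ac : LocAbsCont M₁) (hM₂_ac : LocAbsCont M₂)
    (hM₁_dec : OpDecreasing M₁) (hM₂_dec : OpDecreasing M₂)
    (h_pos : ∀ t, 0 ≤ t →
      M₁ t + (c * (1 - γ) / 4) • adjSelf A - (L / 2) • ContinuousLinearMap.id ℝ H ∈ Splus H)
    {xb : H} {fb gb : ℝ} (hfb : f xb = fb) (hgb : g (A xb) = gb) (yb : G) :
    ∀ᵐ t : ℝ, 0 < t → ∃ fp gq : ℝ, f (deriv x t + x t) = fp ∧ g (deriv z t + z t) = gq ∧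
      fp + h (deriv x t + x t) + gq - (fb + h xb + gb)
        + inner ℝ yb (A (deriv x t + x t) - (deriv z t + z t))
        ≤ -(1 / 2) * deriv (energy A c γ M₁ M₂ x z y xb yb) t := by
  filter_upwards [hM₁_ac.ae_differentiableAt, hM₂_ac.ae_differentiableAt,
    h_sol.locAbsCont_x.ae_differentiableAt, h_sol.locAbsCont_z.ae_differentiableAt,
    h_sol.locAbsCont_y.ae_differentiableAt, (ae_restrict_iff' measurableSet_Ici).1 h_sol.incl_x,
    (ae_restrict_iff' measurableSet_Ici).1 h_sol.incl_z,
    (ae_restrict_iff' measurableSet_Ici).1 h_sol.eq_y] with t d1 d2 d3 d4 d5 ix iz iy ht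
  have hix := ix ht.le
  have hiz := iz ht.le
  simp only [setInv, mem_ofPred_eq, add_singleton, mem_image] at hix hiz
  obtain ⟨v, hv, hv'⟩ := hix
  obtain ⟨w, hw, hw'⟩ := hiz
  obtain ⟨fp, hfp, hle_f⟩ := exists_coe_and_inner_le_of_mem_subdiff hv hfb
  obtain ⟨gq, hgq, hle_g⟩ := exists_coe_and_inner_le_of_mem_subdiff hw hgb
  refine ⟨fp, gq, hfp, hgq, ?_⟩
  rw [eq_sub_of_add_eq hv'] at hle_f
  rw [eq_sub_of_add_eq hw'] at hle_g
  -- The gradient is taken at `x t`, not at the new point: the descent lemma covers the move by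
  -- `deriv x t`, and convexity compares `x t` with `xb`.
  have hh : h (deriv x t + x t) - h xb ≤
      inner ℝ (gradient h (x t)) (deriv x t + x t - xb) + L / 2 * ‖deriv x t‖ ^ 2 := by
    have h1 := le_add_inner_gradient_add h_diff h_lip (x t) (deriv x t)
    have h2 := add_inner_gradient_le h_conv h_diff (x t) (xb - x t)
    rw [add_sub_cancel, inner_sub_right] at h2
    rw [add_comm (x t)] at h1
    rw [inner_sub_right, inner_add_right]
    linarith
  have h1 := energy_estimate (yb := yb) hc hγ hle_f hle_g hh (iy ht.le) (hM₁ t ht.le).isSymmetric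
    (hM₂ t ht.le).isSymmetric (sqNorm_nonneg_of_mem_Splus (h_pos t ht.le) _)
    (sqNorm_nonneg_of_mem_Splus (hM₂ t ht.le) _)
  have h2 := deriv_energy_le (A := A) (c := c) (γ := γ) hM₁ hM₂ hM₁_dec hM₂_dec ht (d1 ht) (d2 ht)
    (d3 ht) (d4 ht) (d5 ht) xb yb
  linarith

/-- The feasibility residual of the time averages is a difference quotient of `y`. -/
theorem IsStrongGlobalSolution.ergodic_residual
    (h_sol : IsStrongGlobalSolution f h g A c γ M₁ M₂ x0 z0 y0 x z y) (hc : 0 < c) {t : ℝ}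
    (ht : 0 < t) :
    A (ergodic x t) - ergodic z t = (1 / (c * t)) • (y t - y0) := by
  have hxi := h_sol.locAbsCont_x.intervalIntegrable_deriv_add ht
  have hzi := h_sol.locAbsCont_z.intervalIntegrable_deriv_add ht
  have hAi : IntervalIntegrable (fun s => A (deriv x s + x s)) volume 0 t :=
    ⟨A.integrable_comp hxi.1, A.integrable_comp hxi.2⟩
  -- The multiplier equation says that `deriv y` is c times the instantaneous residual, so it can be
  -- integrated exactly.
  have hint : c • ∫ s in (0 : ℝ)..t, (A (deriv x s + x s) - (deriv z s + z s)) = y t - y0 := by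
    rw [← h_sol.init_y, ← (h_sol.locAbsCont_y.intervalIntegrable_deriv_and_integral ht).2,
      ← intervalIntegral.integral_smul]
    refine intervalIntegral.integral_congr_ae ?_
    filter_upwards [(ae_restrict_iff' measurableSet_Ici).1 h_sol.eq_y] with s hs hst
    rw [uIoc_of_le ht.le] at hst
    rw [hs hst.1.le, smul_sub, add_comm (x s), add_comm (z s)]
  rw [ergodic, ergodic, ← hint, map_smul, ← smul_sub, ← A.intervalIntegral_comp_comm hxi,
    ← intervalIntegral.integral_sub hAi hzi, smul_smul]
  congr 1
  field_simp

/-- Averages of trajectories lying in a closed convex epigraph. -/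
theorem ergodic_mem_sumEpigraph (hf : ProperConvexLsc f) (hh : ConvexOn ℝ univ h)
    (hh' : Continuous h) (hg : ProperConvexLsc g) (hx : LocAbsCont x) (hz : LocAbsCont z) {t : ℝ}
    (ht : 0 < t) {r : ℝ → ℝ} (hr : IntervalIntegrable r volume 0 t)
    (hmem : ∀ᵐ s : ℝ, 0 < s →
      ((deriv x s + x s, deriv z s + z s), r s) ∈ sumEpigraph f h g) :
    ((ergodic x t, ergodic z t), (1 / t) * ∫ s in (0 : ℝ)..t, r s) ∈ sumEpigraph f h g := by
  have hxi := (hx.intervalIntegrable_deriv_add ht).1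
  have hzi := (hz.intervalIntegrable_deriv_add ht).1
  have key := (convex_sumEpigraph hf hh hg).set_average_mem (μ := volume) (t := Ioc 0 t)
    (f := fun s => ((deriv x s + x s, deriv z s + z s), r s))
    (isClosed_sumEpigraph hf hh' hg) (by simp [ht]) (by simp)
    ((ae_restrict_iff' measurableSet_Ioc).2 (hmem.mono fun s hs hst => hs hst.1))
    ((hxi.prodMk hzi).prodMk hr.1)
  rw [setAverage_eq, integral_pair (hxi.prodMk hzi) hr.1, integral_pair hxi hzi] at key
  simpa [ergodic, intervalIntegral.integral_of_le ht.le, Measure.real, ht.le] using key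

end PrimalDual

/-! ### The feasibility rate and the objective estimate. -/

theorem theorem4p5 {H G : Type*}
    [NormedAddCommGroup H] [InnerProductSpace ℝ H] [CompleteSpace H]
    [NormedAddCommGroup G] [InnerProductSpace ℝ G] [CompleteSpace G]
    (f : H → EReal) (h : H → ℝ) (g : G → EReal) (A : H →L[ℝ] G) (Lh c γ : ℝ)
    (M₁ : ℝ → H →L[ℝ] H) (M₂ : ℝ → G →L[ℝ] G)
    -- the convex problem
    (hf : ProperConvexLsc f) (hg : ProperConvexLsc g)
    (h_conv : ConvexOn ℝ univ h) (h_diff : Differentiable ℝ h) (hLh : 0 ≤ Lh)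
    (h_lip : ∀ u v : H, ‖gradient h u - gradient h v‖ ≤ Lh * ‖u - v‖)
    -- the parameters of the dynamical system
    (hc : 0 < c) (hγ : γ ∈ Icc (0 : ℝ) 1)
    (hM₁ : ∀ t, 0 ≤ t → M₁ t ∈ Splus H) (hM₂ : ∀ t, 0 ≤ t → M₂ t ∈ Splus G)
    -- the hypotheses of the theorem
    (h_saddle : ∃ (xs : H) (zs ys : G), IsSaddlePoint f h g A xs zs ys)
    (hM₁_ac : LocAbsCont M₁) (hM₂_ac : LocAbsCont M₂)
    (hM₁_dec : OpDecreasing M₁) (hM₂_dec : OpDecreasing M₂)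
    (h_pos : ∀ t, 0 ≤ t →
      M₁ t + (c * (1 - γ) / 4) • adjSelf A - (Lh / 2) • ContinuousLinearMap.id ℝ H ∈ Splus H)
    (hM₁_bdd : ∃ C : ℝ, ∀ᵐ t ∂(volume.restrict (Ici (0 : ℝ))), ‖deriv M₁ t‖ ≤ C)
    (hM₂_bdd : ∃ C : ℝ, ∀ᵐ t ∂(volume.restrict (Ici (0 : ℝ))), ‖deriv M₂ t‖ ≤ C)
    (h_cases :
      (∃ α : ℝ, 0 < α ∧ ∀ t, 0 ≤ t →
        M₁ t + (c * (1 - γ) / 4) • adjSelf A - (Lh / 4) • ContinuousLinearMap.id ℝ H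
          ∈ Pclass H α) ∨
      (γ < 1 ∧ ∃ α : ℝ, 0 < α ∧ adjSelf A ∈ Pclass H α))
    -- the trajectory
    (x0 : H) (z0 y0 : G) (x : ℝ → H) (z y : ℝ → G)
    (h_sol : IsStrongGlobalSolution f h g A c γ M₁ M₂ x0 z0 y0 x z y) :
    (∃ K : ℝ, 0 ≤ K ∧ ∀ t : ℝ, 0 < t → ‖A (ergodic x t) - ergodic z t‖ ≤ K / t) ∧
    (∀ (xbar : H) (t : ℝ), 0 < t → ergodic x t ∈ effDom f → ergodic z t ∈ effDom g →
      (f (ergodic x t) + (h (ergodic x t) : EReal) + g (ergodic z t))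
          - (f xbar + (h xbar : EReal) + g (A xbar))
        ≤ ((sqNormProd (Wop A c γ M₁ M₂ 0) ((x0, z0, y0) - (xbar, A xbar, 0)) / (2 * t) : ℝ)
            : EReal)) := by
  have hE : ∀ (xb : H) (yb : G) {T : ℝ}, 0 < T →
      AbsolutelyContinuousOnInterval (energy A c γ M₁ M₂ x z y xb yb) 0 T :=
    fun xb yb {T} hT => absolutelyContinuousOnInterval_energy hM₁_ac hM₂_ac h_sol.locAbsCont_x
      h_sol.locAbsCont_z h_sol.locAbsCont_y xb yb hT
  have hdiss := fun {xb : H} {fb gb : ℝ} (hfb : f xb = fb) (hgb : g (A xb) = gb) (yb : G) =>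
    h_sol.ae_dissipation h_conv h_diff h_lip hc hγ hM₁ hM₂ hM₁_ac hM₂_ac hM₁_dec hM₂_dec h_pos
      hfb hgb yb
  refine ⟨?_, ?_⟩
  · obtain ⟨xs, zs, ys, hs⟩ := h_saddle
    obtain ⟨-, fs, gs, hfs, hgs, hmin⟩ := hs.feasible_and_le hf hg
    -- The radius comes from ‖y(t) - y*‖²/c ≤ V(t) ≤ V(0); V decreases because the saddle inequality
    -- makes the left side of the dissipation estimate nonnegative.
    have hV : ∀ t, 0 ≤ t →
        ‖y t - ys‖ ≤ Real.sqrt (c * energy A c γ M₁ M₂ x z y xs ys 0) := by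
      intro t ht
      have hdec : energy A c γ M₁ M₂ x z y xs ys t ≤ energy A c γ M₁ M₂ x z y xs ys 0 := by
        rcases ht.eq_or_lt with rfl | ht
        · exact le_rfl
        have h1 := (hE xs ys ht).integral_deriv_eq_sub
        have h2 : 0 ≤ ∫ s in (0 : ℝ)..t, -deriv (energy A c γ M₁ M₂ x z y xs ys) s := by
          refine intervalIntegral.integral_nonneg_of_ae_restrict ht.le ?_
          refine (ae_restrict_iff' measurableSet_Icc).2 ?_
          have hne : ∀ᵐ s : ℝ, s ≠ 0 := by simp [ae_iff, measure_singleton]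
          filter_upwards [hdiss hfs hgs ys, hne] with s hs hs0 hst
          obtain ⟨fp, gq, hfp, hgq, hle⟩ := hs (lt_of_le_of_ne hst.1 (Ne.symm hs0))
          have h3 := hmin _ _ fp gq hfp hgq
          simp only [Pi.zero_apply]
          linarith
        rw [intervalIntegral.integral_neg] at h2
        linarith
      have h4 := (norm_sq_div_le_energy (A := A) (x := x) (z := z) (y := y) hc hγ (hM₁ t ht)
        (hM₂ t ht) xs ys).trans hdec
      rw [div_le_iff₀ hc] at h4
      exact Real.le_sqrt_of_sq_le (by linarith)
    set R := Real.sqrt (c * energy A c γ M₁ M₂ x z y xs ys 0)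
    refine ⟨2 * R / c, by positivity, fun t ht => ?_⟩
    rw [h_sol.ergodic_residual hc ht, norm_smul, Real.norm_of_nonneg (by positivity)]
    have h5 : ‖y t - y0‖ ≤ 2 * R := by
      have h6 := hV t ht.le
      have h7 := hV 0 le_rfl
      rw [h_sol.init_y, norm_sub_rev] at h7
      calc ‖y t - y0‖ ≤ ‖y t - ys‖ + ‖ys - y0‖ := norm_sub_le_norm_sub_add_norm_sub _ _ _
        _ ≤ 2 * R := by linarith
    calc 1 / (c * t) * ‖y t - y0‖ ≤ 1 / (c * t) * (2 * R) := by gcongr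
      _ = 2 * R / c / t := by field_simp
  · intro xbar t ht _ _
    -- When the reference value is `⊤`, the difference is `⊥` by the `EReal` convention a - `⊤` =
    -- `⊥`, and the bound is trivial.
    by_cases hfb : f xbar = ⊤
    · rw [hfb, EReal.top_add_coe, EReal.top_add_of_ne_bot (hg.ne_bot _), EReal.sub_top]
      exact bot_le
    obtain ⟨fb, hfb⟩ := hf.exists_coe hfb
    by_cases hgb : g (A xbar) = ⊤
    · rw [hgb, hfb, ← EReal.coe_add, EReal.coe_add_top, EReal.sub_top]
      exact bot_le
    obtain ⟨gb, hgb⟩ := hg.exists_coe hgb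
    have hac := hE xbar 0 ht
    -- The heights `r` are the upper bounds from the dissipation estimate with zero multiplier; they
    -- are integrable, and the integral of V' telescopes.
    have hmem := ergodic_mem_sumEpigraph hf h_conv h_diff.continuous hg h_sol.locAbsCont_x
      h_sol.locAbsCont_z ht
      (r := fun s => (fb + h xbar + gb) - 1 / 2 * deriv (energy A c γ M₁ M₂ x z y xbar 0) s)
      ((intervalIntegrable_const).sub (hac.intervalIntegrable_deriv.const_mul _)) (by
        filter_upwards [hdiss hfb hgb 0] with s hs hs0
        obtain ⟨fp, gq, hfp, hgq, hle⟩ := hs hs0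
        rw [inner_zero_left] at hle
        simp only [sumEpigraph, mem_ofPred_eq, hfp, hgq]
        have h1 : fp + h (deriv x s + x s) + gq ≤ (fb + h xbar + gb)
          - 1 / 2 * deriv (energy A c γ M₁ M₂ x z y xbar 0) s := by linarith
        exact_mod_cast h1)
    obtain ⟨fe, ge, hfe, hge, hle⟩ := hf.exists_coe_of_add_le hg hmem
    dsimp only at hfe hge hle
    rw [intervalIntegral.integral_sub intervalIntegrable_const
      (hac.intervalIntegrable_deriv.const_mul _), intervalIntegral.integral_const_mul,
      hac.integral_deriv_eq_sub, intervalIntegral.integral_const, smul_eq_mul, sub_zero] at hle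
    have hnn : 0 ≤ energy A c γ M₁ M₂ x z y xbar 0 t :=
      le_trans (by positivity) (norm_sq_div_le_energy (A := A) (x := x) (z := z) (y := y) hc hγ
        (hM₁ t ht.le) (hM₂ t ht.le) xbar 0)
    have h0 : energy A c γ M₁ M₂ x z y xbar 0 0
        = sqNormProd (Wop A c γ M₁ M₂ 0) ((x0, z0, y0) - (xbar, A xbar, 0)) := by
      rw [energy, h_sol.init_x, h_sol.init_z, h_sol.init_y]
    rw [← h0, hfe, hge, hfb, hgb]
    have hfinal : fe + h (ergodic x t) + ge - (fb + h xbar + gb)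
        ≤ energy A c γ M₁ M₂ x z y xbar 0 0 / (2 * t) := by
      -- The averaged height is the reference value plus (V(0) - V(t))/(2t), and V(t) ≥ 0 is
      -- discarded.
      have h1 : 1 / t * (t * (fb + h xbar + gb) - 1 / 2 * (energy A c γ M₁ M₂ x z y xbar 0 t
          - energy A c γ M₁ M₂ x z y xbar 0 0)) = (fb + h xbar + gb)
          + energy A c γ M₁ M₂ x z y xbar 0 0 / (2 * t)
          - energy A c γ M₁ M₂ x z y xbar 0 t / (2 * t) := by
        field_simp
        ring
      have h2 : 0 ≤ energy A c γ M₁ M₂ x z y xbar 0 t / (2 * t) := by positivity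
      linarith
    exact_mod_cast hfinal
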